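/- Let $n\ge 1$ and let $\Sigma_n=\{1,2,\dots,n\}$. Let $P_n$ be the language of all words over $\Sigma_n$ that are permutations of $\Sigma_n$, that is, in which every letter of $\Sigma_n$ occurs exactly once. Regular expressions over $\Sigma_n$ are built from $\emptyset$, $\varepsilon$ and the letters of $\Sigma_n$ by union ($+$), concatenation and Kleene star; the alphabetic length of a regular expression is the number of occurrences of letters of $\Sigma_n$ in it. For a nonempty finite alphabet $S$ define the divide-and-conquer regular expression $E(S)$ recursively by $E(\{i\})=i$ and $$E(S)=\sum_{T\subseteq S,\ |T|=\lfloor |S|/2\rfloor} (E(T))(E(S-T))\qquad\text{for } |S|\ge 2,$$ where the sum denotes the union, taken over the sets $T$ in colexicographic order, and let $R_n=E(\Sigma_n)$. Define $f(1)=1$ and $$f(n)=\binom{n}{\lfloor n/2\rfloor}\bigl(f(\lfloor n/2\rfloor)+f(\lceil n/2\rceil)\bigr)\qquad\text{for } n>1.$$ Then $R_n$ specifies $P_n$, the alphabetic length of $R_n$ is $f(n)$, and every regular expression over $\Sigma_n$ that specifies $P_n$ has alphabetic length at least that of $R_n$. Hence the minimum alphabetic length of a regular expression specifying $P_n$ is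 $f(n)$, and $R_n$ attains it. -/

import Mathlib

namespace PermLang

/-- The alphabetic length of a regular expression: the number of occurrences of alphabet symbols
(all other symbols, such as parentheses, `+`, `∗`, `ε` and `∅`, are ignored). -/
def alphabeticLength {α : Type*} : RegularExpression α → ℕ
  | .zero => 0
  | .epsilon => 0
  | .char _ => 1
  | .plus r s => alphabeticLength r + alphabeticLength s
  | .comp r s => alphabeticLength r + alphabeticLength s
  | .star r => alphabeticLength r

/-- The permutation language `P_n`: all words that are permutations of the alphabet with `n`
letters. -/
def permLanguage (n : ℕ) : Language (Fin n) :=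
  {w | w.Perm (List.finRange n)}

/-- The union `r₁ + (r₂ + (⋯ + r_m))` of a list of regular expressions, in the given order. -/
def unionList {α : Type*} : List (RegularExpression α) → RegularExpression α
  | [] => 0
  | [r] => r
  | r :: s :: l => r + unionList (s :: l)

/-- The subsets of `S` of cardinality `⌊|S| / 2⌋`, listed in colexicographic order
(for `S = {1, 2, 3, 4}`: `12, 13, 23, 14, 24, 34`). -/
def halves {α : Type*} [LinearOrder α] (S : Finset α) : List (Finset α) :=
  (((S.powersetCard (S.card / 2)).map (toColex (α := Finset α)).toEmbedding).sort (· ≤ ·)).map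
    ofColex

theorem mem_halves {α : Type*} [LinearOrder α] {S T : Finset α} :
    T ∈ halves S ↔ T ⊆ S ∧ T.card = S.card / 2 := by
  simp [halves, Finset.mem_powersetCard]

/-- The divide-and-conquer expression `E(S)` for the permutations of the letters of `S`:
`E({i}) = i`, and `E(S)` is the union of the `E(T) E(S - T)` over all `T ⊆ S` with
`|T| = ⌊|S| / 2⌋` when `|S| ≥ 2`. (The empty alphabet, which plays no role, is sent to `ε`.) -/
def divideConquer {α : Type*} [LinearOrder α] (S : Finset α) : RegularExpression α :=
  if h₀ : S.card = 0 then 1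
  else if h₁ : S.card = 1 then
    .char (S.min' (Finset.card_pos.mp (by omega)))
  else
    unionList ((halves S).attach.map fun T => divideConquer T.1 * divideConquer (S \ T.1))
termination_by S.card
decreasing_by
  all_goals
    obtain ⟨hT, hc⟩ := mem_halves.mp T.2
    first
      | omega
      | (rw [Finset.card_sdiff_of_subset hT]; omega)

/-- The regular expression `R_n = E(Σ_n)`. -/
def R (n : ℕ) : RegularExpression (Fin n) :=
  divideConquer Finset.univ

/-- `f(1) = 1` and `f(n) = C(n, ⌊n/2⌋) (f(⌊n/2⌋) + f(⌈n/2⌉))` for `n > 1`; the value at `0` plays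
no role. Here `(n + 1) / 2` is `⌈n/2⌉`. -/
def f (n : ℕ) : ℕ :=
  if n = 0 then 0
  else if n = 1 then 1
  else n.choose (n / 2) * (f (n / 2) + f ((n + 1) / 2))
termination_by n
decreasing_by all_goals omega

end PermLang

/-!
For the lower bound, consider an expression all of whose words are rearrangements of one multiset of
`n` letters. It specifies at most `n! / f n` words per letter occurrence, by induction on the
expression. A starred expression contributes only the empty word, and unions are additive. The
factors of a nonempty concatenation again consist of rearrangements of fixed multisets, of sizes
`k + m = n`, so they have at most `k!` and `m!` words, and the induction step becomes
`f (k + m) ≤ C(k + m, k) (f k + f m)`: no split of the letters beats the balanced one. As `P_n` has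
`n!` words, an expression for it has at least `f n` letter occurrences.

If `k + 2 ≤ m`, the term `f k` can even be dropped. For `m ≤ 3 k + 3`, moving the split away from
the middle one letter at a time does not decrease `C(k + m, k) f m`, because `3 f m ≤ f (m + 1)`.
For larger `m`, the bound follows by induction, applied to both halves of a balanced split of the
letters that also splits the block of size `m` evenly.
-/

namespace PermLang

open scoped Nat

section Arithmetic

theorem f_zero : f 0 = 0 := by
  rw [f, if_pos rfl]

theorem f_one : f 1 = 1 := by
  rw [f, if_neg one_ne_zero, if_pos rfl]

theorem f_eq_choose_half_mul (n : ℕ) :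
    f n = n.choose (n / 2) * (f (n / 2) + f (n - n / 2)) := by
  match n with
  | 0 => simp [f_zero]
  | 1 => simp [f_zero]
  | n + 2 =>
    rw [f, if_neg (by omega), if_neg (by omega),
      show (n + 2 + 1) / 2 = n + 2 - (n + 2) / 2 by omega]

theorem f_add_of_balanced {k m : ℕ} (hkm : k ≤ m) (hmk : m ≤ k + 1) :
    f (k + m) = (k + m).choose k * (f k + f m) := by
  rw [f_eq_choose_half_mul, show (k + m) / 2 = k by omega, Nat.add_sub_cancel_left]

theorem three_mul_choose_add_self_le {j : ℕ} (hj : 0 < j) :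
    3 * (j + j).choose j ≤ 2 * (j + (j + 1)).choose j := by
  have hstep : (j + j).choose j * (j + j + 1) = (j + (j + 1)).choose j * (j + 1) := by
    rw [Nat.choose_mul_succ_eq, show j + j + 1 - j = j + 1 by omega, add_assoc]
  nlinarith

theorem choose_add_self_succ (j : ℕ) :
    (j + 1 + (j + 1)).choose (j + 1) = 2 * (j + (j + 1)).choose j := by
  rw [show j + 1 + (j + 1) = j + (j + 1) + 1 by ring, Nat.choose_succ_succ', ← Nat.choose_symm_add,
    two_mul]

theorem three_mul_f_le (n : ℕ) : 3 * f n ≤ f (n + 1) := by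
  induction n using Nat.strong_induction_on with
  | _ n ih =>
  obtain ⟨j, rfl | rfl⟩ := Nat.even_or_odd' n
  · rcases Nat.eq_zero_or_pos j with rfl | hj
    · simp [f_zero]
    have ihj : 3 * f j ≤ f (j + 1) := ih j (by omega)
    calc 3 * f (2 * j) = 3 * (j + j).choose j * (2 * f j) := by
          rw [two_mul, f_add_of_balanced le_rfl (by omega)]; ring
      _ ≤ 2 * (j + (j + 1)).choose j * (2 * f j) := by
          gcongr ?_ * _; exact three_mul_choose_add_self_le hj
      _ = (j + (j + 1)).choose j * (f j + 3 * f j) := by ring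
      _ ≤ (j + (j + 1)).choose j * (f j + f (j + 1)) := by gcongr
      _ = f (2 * j + 1) := by
          rw [← f_add_of_balanced (by omega) le_rfl, two_mul, add_assoc]
  · have ihj : 3 * f j ≤ f (j + 1) := ih j (by omega)
    calc 3 * f (2 * j + 1) = (j + (j + 1)).choose j * (3 * f j + 3 * f (j + 1)) := by
          rw [two_mul, add_assoc, f_add_of_balanced (by omega) le_rfl]; ring
      _ ≤ (j + (j + 1)).choose j * (f (j + 1) + 3 * f (j + 1)) := by gcongr
      _ = 2 * (j + (j + 1)).choose j * (f (j + 1) + f (j + 1)) := by ring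
      _ = f (2 * j + 1 + 1) := by
          rw [← choose_add_self_succ, ← f_add_of_balanced le_rfl (by omega)]; congr 1; ring

theorem choose_succ_mul_le_choose_mul_f {k m x : ℕ} (h : (m + 1) * x ≤ 3 * (k + 1) * f m) :
    (k + 1 + m).choose (k + 1) * x ≤ (k + (m + 1)).choose k * f (m + 1) := by
  have hstep : (k + 1 + m).choose (k + 1) * (k + 1) = (k + (m + 1)).choose k * (m + 1) := by
    rw [Nat.choose_succ_right_eq, show k + 1 + m - k = m + 1 by omega, add_assoc, add_comm 1]
  refine Nat.le_of_mul_le_mul_left ?_ k.succ_pos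
  calc (k + 1) * ((k + 1 + m).choose (k + 1) * x)
      = (k + (m + 1)).choose k * ((m + 1) * x) := by rw [← mul_assoc, ← mul_assoc, ← hstep]; ring
    _ ≤ (k + (m + 1)).choose k * (3 * (k + 1) * f m) := by gcongr
    _ = (k + 1) * ((k + (m + 1)).choose k * (3 * f m)) := by ring
    _ ≤ (k + 1) * ((k + (m + 1)).choose k * f (m + 1)) := by gcongr; exact three_mul_f_le m

theorem f_add_le_choose_mul_of_le {k m : ℕ} (hk : 0 < k) (hkm : k + 2 ≤ m)
    (hmk : m ≤ 3 * k + 3) : f (k + m) ≤ (k + m).choose k * f m := by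
  obtain ⟨m, rfl⟩ : ∃ l, m = l + 1 := ⟨m - 1, by omega⟩
  suffices ∃ x, f (k + 1 + m) ≤ (k + 1 + m).choose (k + 1) * x ∧
      (m + 1) * x ≤ 3 * (k + 1) * f m by
    obtain ⟨x, hfx, hx⟩ := this
    rw [show f (k + (m + 1)) = f (k + 1 + m) by congr 1; ring]
    exact hfx.trans (choose_succ_mul_le_choose_mul_f hx)
  rcases (show m = k + 1 ∨ m = k + 1 + 1 ∨ k + 1 + 2 ≤ m by omega) with rfl | rfl | hlt
  · refine ⟨_, (f_add_of_balanced le_rfl (by omega)).le, ?_⟩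
    calc (k + 1 + 1) * (f (k + 1) + f (k + 1)) = 2 * (k + 2) * f (k + 1) := by ring
      _ ≤ 3 * (k + 1) * f (k + 1) := Nat.mul_le_mul_right _ (by omega)
  · refine ⟨_, (f_add_of_balanced (by omega) le_rfl).le, ?_⟩
    have hgrowth : 3 * f (k + 1) ≤ f (k + 1 + 1) := three_mul_f_le (k + 1)
    refine Nat.le_of_mul_le_mul_left ?_ three_pos
    calc 3 * ((k + 1 + 1 + 1) * (f (k + 1) + f (k + 1 + 1)))
        = (k + 3) * (3 * f (k + 1) + 3 * f (k + 1 + 1)) := by ring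
      _ ≤ (k + 3) * (f (k + 1 + 1) + 3 * f (k + 1 + 1)) := by gcongr
      _ = 4 * (k + 3) * f (k + 1 + 1) := by ring
      _ ≤ 9 * (k + 1) * f (k + 1 + 1) := Nat.mul_le_mul_right _ (by omega)
      _ = 3 * (3 * (k + 1) * f (k + 1 + 1)) := by ring
  · exact ⟨_, f_add_le_choose_mul_of_le k.succ_pos hlt (by omega),
      Nat.mul_le_mul_right _ (by omega)⟩
termination_by m - k

theorem choose_mul_choose_mul_factorials (a b c : ℕ) :
    (a + b + c).choose (a + b) * (a + b).choose a * (a ! * b ! * c !) = (a + b + c)! := by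
  rw [← Nat.add_choose_mul_factorial_mul_factorial (a + b) c,
    ← Nat.add_choose_mul_factorial_mul_factorial a b, Nat.choose_symm_add, Nat.choose_symm_add]
  ring

theorem add_factorial_mul_factorial_le {a d : ℕ} (had : a ≤ d) (c : ℕ) :
    (a + c)! * d ! ≤ a ! * (d + c)! := by
  induction c with
  | zero => exact le_rfl
  | succ c ih =>
    calc (a + (c + 1))! * d ! = (a + c + 1) * ((a + c)! * d !) := by
          rw [← add_assoc, Nat.factorial_succ, mul_assoc]
      _ ≤ (d + c + 1) * (a ! * (d + c)!) := by gcongr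
      _ = a ! * (d + (c + 1))! := by rw [← add_assoc, Nat.factorial_succ, mul_left_comm]

theorem choose_mul_choose_le {a b c d : ℕ} (had : a ≤ d) :
    (a + b + (c + d)).choose (a + b) * (a + b).choose a ≤
      (b + d + (a + c)).choose (b + d) * (b + d).choose b := by
  -- The factor `1 / b!` is common, so the claim is `(a + c)! d! ≤ a! (d + c)!`.
  refine Nat.le_of_mul_le_mul_right ?_ (show 0 < b ! * (a ! * (d + c)!) by positivity)
  calc (a + b + (c + d)).choose (a + b) * (a + b).choose a * (b ! * (a ! * (d + c)!))
      = (a + b + (c + d))! := by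
        rw [← choose_mul_choose_mul_factorials, add_comm d c]; ring
    _ = (b + d + (a + c)).choose (b + d) * (b + d).choose b * (b ! * ((a + c)! * d !)) := by
        rw [show a + b + (c + d) = b + d + (a + c) by ring, ← choose_mul_choose_mul_factorials]
        ring
    _ ≤ (b + d + (a + c)).choose (b + d) * (b + d).choose b * (b ! * (a ! * (d + c)!)) := by
        gcongr _ * (_ * ?_); exact add_factorial_mul_factorial_le had c

theorem f_add_le_choose_mul {k m : ℕ} (hkm : k + 2 ≤ m) :
    f (k + m) ≤ (k + m).choose k * f m := by
  obtain rfl | hk := Nat.eq_zero_or_pos k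
  · simp
  by_cases hmk : m ≤ 3 * k + 3
  · exact f_add_le_choose_mul_of_le hk hkm hmk
  obtain ⟨a, b, hab, hba, rfl⟩ : ∃ a b, a ≤ b ∧ b ≤ a + 1 ∧ m = a + b :=
    ⟨m / 2, m - m / 2, by omega⟩
  obtain ⟨p, q, hpq, hqp, rfl⟩ : ∃ p q, p + a ≤ q + b ∧ q + b ≤ p + a + 1 ∧ k = p + q :=
    ⟨(k + (a + b)) / 2 - a, k - ((k + (a + b)) / 2 - a), by omega⟩
  set C := (a + b + (p + q)).choose (a + b) * (a + b).choose a with hC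
  have hp : (p + a + (q + b)).choose (p + a) * (p + a).choose p ≤ C :=
    choose_mul_choose_le (by omega)
  have hq : (p + a + (q + b)).choose (p + a) * (q + b).choose q ≤ C := by
    rw [hC, Nat.choose_symm_add (a := p + a), Nat.choose_symm_add (a := a), add_comm (p + a),
      add_comm p q, add_comm a b]
    exact choose_mul_choose_le (by omega)
  calc f (p + q + (a + b)) = (p + a + (q + b)).choose (p + a) * (f (p + a) + f (q + b)) := by
        rw [← f_add_of_balanced hpq hqp, add_add_add_comm]
    _ ≤ (p + a + (q + b)).choose (p + a) *
          ((p + a).choose p * f a + (q + b).choose q * f b) := by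
        gcongr <;> exact f_add_le_choose_mul (by omega)
    _ = (p + a + (q + b)).choose (p + a) * (p + a).choose p * f a +
          (p + a + (q + b)).choose (p + a) * (q + b).choose q * f b := by ring
    _ ≤ C * f a + C * f b := by gcongr
    _ = (p + q + (a + b)).choose (p + q) * f (a + b) := by
        rw [hC, f_add_of_balanced hab hba, add_comm (p + q), ← Nat.choose_symm_add]; ring
termination_by k + m

theorem f_add_le (k m : ℕ) : f (k + m) ≤ (k + m).choose k * (f k + f m) := by
  wlog h : k ≤ m generalizing k m
  · simpa only [add_comm m k, add_comm (f m), ← Nat.choose_symm_add] using this m k (by omega)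
  by_cases hkm : k + 2 ≤ m
  · exact (f_add_le_choose_mul hkm).trans (by gcongr; omega)
  · exact (f_add_of_balanced h (by omega)).le

end Arithmetic

section Rearrangements

variable {α : Type*} {K L : Language α} {s : Multiset α}

/-- The language of all words in which every letter occurs as often as in the multiset `s`. The
permutations of a finite alphabet `S` form `rearrangements S.val`; multisets are used because they
are additive under concatenation. -/
def rearrangements (s : Multiset α) : Language α :=
  {w | (w : Multiset α) = s}

theorem mem_rearrangements {w : List α} : w ∈ rearrangements s ↔ (w : Multiset α) = s :=
  Iff.rfl

theorem eq_zero_of_nil_mem (hL : L ≤ rearrangements s) (h : [] ∈ L) : s = 0 :=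
  (hL h).symm

theorem exists_le_rearrangements_of_mul_le {w : List α} (hw : w ∈ K * L)
    (h : K * L ≤ rearrangements s) :
    ∃ t u, t + u = s ∧ K ≤ rearrangements t ∧ L ≤ rearrangements u := by
  obtain ⟨x, hx, y, hy, rfl⟩ := Language.mem_mul.mp hw
  have hcontent {x' y' : List α} (hx' : x' ∈ K) (hy' : y' ∈ L) : (x' : Multiset α) + y' = s :=
    h (Language.append_mem_mul hx' hy')
  refine ⟨x, y, hcontent hx hy, fun x' hx' => ?_, fun y' hy' => ?_⟩
  · exact add_right_cancel ((hcontent hx' hy).trans (hcontent hx hy).symm)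
  · exact add_left_cancel ((hcontent hx hy').trans (hcontent hx hy).symm)

theorem mem_rearrangements_val_iff_exists_mem_mul [DecidableEq α] {S : Finset α} {k : ℕ}
    (hk : k ≤ S.card) {w : List α} :
    w ∈ rearrangements S.val ↔
      ∃ T ⊆ S, T.card = k ∧ w ∈ rearrangements T.val * rearrangements (S \ T).val := by
  constructor
  · intro hw
    have hadd : (w.take k : Multiset α) + (w.drop k : Multiset α) = S.val := by
      rw [Multiset.coe_add, List.take_append_drop, mem_rearrangements.mp hw]
    have hle : (w.take k : Multiset α) ≤ S.val := hadd ▸ Multiset.le_add_right _ _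
    refine ⟨⟨w.take k, Multiset.nodup_of_le hle S.nodup⟩, Finset.val_le_iff.mp hle, ?_, ?_⟩
    · have hlen : w.length = S.card := congrArg Multiset.card (mem_rearrangements.mp hw)
      simpa [hlen] using hk
    · refine Language.mem_mul.mpr ⟨w.take k, rfl, w.drop k, ?_, List.take_append_drop k w⟩
      rw [mem_rearrangements, Finset.sdiff_val]
      exact eq_tsub_of_add_eq ((add_comm _ _).trans hadd)
  · rintro ⟨T, hTS, -, hw⟩
    obtain ⟨x, hx, y, hy, rfl⟩ := Language.mem_mul.mp hw
    rw [mem_rearrangements, ← Multiset.coe_add, mem_rearrangements.mp hx,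
      mem_rearrangements.mp hy, Finset.sdiff_val, add_tsub_cancel_of_le (Finset.val_le_iff.mpr hTS)]

/-- The number of words of a finite language, the quantity that is compared with the alphabetic
length in the lower bound; an infinite language gets the junk value `0`. -/
noncomputable def numWords (L : Language α) : ℕ :=
  Set.ncard {w | w ∈ L}

theorem numWords_zero : numWords (0 : Language α) = 0 :=
  Set.ncard_empty _

theorem numWords_singleton (w : List α) : numWords ({w} : Language α) = 1 :=
  Set.ncard_singleton w

theorem numWords_add_le (K L : Language α) : numWords (K + L) ≤ numWords K + numWords L :=
  Set.ncard_union_le _ _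

theorem numWords_mul_le (hK : {w | w ∈ K}.Finite) (hL : {w | w ∈ L}.Finite) :
    numWords (K * L) ≤ numWords K * numWords L := by
  have h : {w | w ∈ K * L} =
      (fun p : List α × List α => p.1 ++ p.2) '' ({w | w ∈ K} ×ˢ {w | w ∈ L}) :=
    (Set.image_prod _).symm
  rw [numWords, numWords, numWords, ← Set.ncard_prod, h]
  exact Set.ncard_image_le (hK.prod hL)

theorem setOf_mem_rearrangements [DecidableEq α] (s : Multiset α) :
    {w | w ∈ rearrangements s} = (s.lists.toFinset : Set (List α)) := by
  ext w
  simp [mem_rearrangements, eq_comm]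

theorem finite_of_le_rearrangements (hL : L ≤ rearrangements s) : {w | w ∈ L}.Finite := by
  classical
  exact (Finset.finite_toSet _).subset (hL.trans (setOf_mem_rearrangements s).le)

theorem card_lists (s : Multiset α) : s.lists.card = (s.card)! := by
  induction s using Quotient.inductionOn with
  | h l => exact List.length_permutations l

theorem numWords_le_factorial_of_le_rearrangements (hL : L ≤ rearrangements s) :
    numWords L ≤ s.card ! := by
  classical
  calc numWords L ≤ (s.lists.toFinset : Set (List α)).ncard :=
        Set.ncard_le_ncard (hL.trans (setOf_mem_rearrangements s).le) (Finset.finite_toSet _)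
    _ ≤ s.lists.card := by rw [Set.ncard_coe_finset]; exact s.lists.toFinset_card_le
    _ = s.card ! := card_lists s

theorem numWords_rearrangements_val (S : Finset α) :
    numWords (rearrangements S.val) = S.card ! := by
  classical
  rw [numWords, setOf_mem_rearrangements, Set.ncard_coe_finset,
    Multiset.toFinset_card_of_nodup (Multiset.lists_nodup_finset S), card_lists, Finset.card_val]

end Rearrangements

section LowerBound

variable {α : Type*}

theorem mul_mul_f_add_le {a b k m x y : ℕ} (hak : a ≤ k !) (hbm : b ≤ m !)
    (hx : a * f k ≤ x * k !) (hy : b * f m ≤ y * m !) :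
    a * b * f (k + m) ≤ (x + y) * (k + m)! := by
  calc a * b * f (k + m) ≤ a * b * ((k + m).choose k * (f k + f m)) := by
        gcongr; exact f_add_le k m
    _ = (k + m).choose k * (a * f k * b + a * (b * f m)) := by ring
    _ ≤ (k + m).choose k * (x * k ! * m ! + k ! * (y * m !)) := by gcongr
    _ = (x + y) * ((k + m).choose m * k ! * m !) := by rw [Nat.choose_symm_add]; ring
    _ = (x + y) * (k + m)! := by rw [Nat.add_choose_mul_factorial_mul_factorial]

theorem numWords_matches'_mul_f_le (r : RegularExpression α) {s : Multiset α}
    (h : r.matches' ≤ rearrangements s) :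
    numWords r.matches' * f s.card ≤ alphabeticLength r * s.card ! := by
  induction r generalizing s with
  | zero => exact (Nat.mul_eq_zero.mpr (.inl numWords_zero)).trans_le (Nat.zero_le _)
  | epsilon => simp [eq_zero_of_nil_mem h Language.nil_mem_one, f_zero]
  | char a =>
    have hs : ([a] : Multiset α) = s := h (Set.mem_singleton [a])
    simp [← hs, f_one, alphabeticLength, numWords_singleton]
  | plus q r ihq ihr =>
    obtain ⟨hq, hr⟩ := add_le_iff.mp h
    calc numWords (q.matches' + r.matches') * f s.card
        ≤ numWords q.matches' * f s.card + numWords r.matches' * f s.card := by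
          rw [← add_mul]; gcongr; exact numWords_add_le _ _
      _ ≤ alphabeticLength q * s.card ! + alphabeticLength r * s.card ! :=
          add_le_add (ihq hq) (ihr hr)
      _ = (alphabeticLength q + alphabeticLength r) * s.card ! := (add_mul _ _ _).symm
  | comp q r ihq ihr =>
    obtain hempty | ⟨w, hw⟩ := Set.eq_empty_or_nonempty {w | w ∈ q.matches' * r.matches'}
    · simp [numWords, hempty]
    obtain ⟨t, u, rfl, hq, hr⟩ := exists_le_rearrangements_of_mul_le hw h
    calc numWords (q.matches' * r.matches') * f (t + u).card
        ≤ numWords q.matches' * numWords r.matches' * f (t.card + u.card) := by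
          rw [Multiset.card_add]
          gcongr
          exact numWords_mul_le (finite_of_le_rearrangements hq) (finite_of_le_rearrangements hr)
      _ ≤ (alphabeticLength q + alphabeticLength r) * (t.card + u.card)! :=
          mul_mul_f_add_le (numWords_le_factorial_of_le_rearrangements hq)
            (numWords_le_factorial_of_le_rearrangements hr) (ihq hq) (ihr hr)
      _ = (alphabeticLength q + alphabeticLength r) * (t + u).card ! := by
          rw [Multiset.card_add]
  | star r => simp [eq_zero_of_nil_mem h (Language.nil_mem_kstar _), f_zero]

theorem f_card_le_alphabeticLength {S : Finset α} {r : RegularExpression α}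
    (hr : r.matches' = rearrangements S.val) : f S.card ≤ alphabeticLength r := by
  have h := numWords_matches'_mul_f_le r hr.le
  rw [hr, numWords_rearrangements_val, mul_comm, Finset.card_val] at h
  exact Nat.le_of_mul_le_mul_right h S.card.factorial_pos

end LowerBound

section DivideConquer

variable {α : Type*}

theorem mem_matches'_unionList {l : List (RegularExpression α)} {w : List α} :
    w ∈ (unionList l).matches' ↔ ∃ r ∈ l, w ∈ r.matches' := by
  fun_induction unionList l with
  | case1 => simp [Language.notMem_zero]
  | case2 r => simp
  | case3 r s l ih => simp [Language.mem_add, ih]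

theorem alphabeticLength_unionList (l : List (RegularExpression α)) :
    alphabeticLength (unionList l) = (l.map alphabeticLength).sum := by
  fun_induction unionList l with
  | case1 => rfl
  | case2 r => simp
  | case3 r s l ih => rw [List.map_cons, List.sum_cons, ← ih]; rfl

variable [LinearOrder α]

theorem length_halves (S : Finset α) : (halves S).length = S.card.choose (S.card / 2) := by
  simp [halves]

theorem divideConquer_empty : divideConquer (∅ : Finset α) = 1 := by
  rw [divideConquer, dif_pos Finset.card_empty]

theorem divideConquer_singleton (a : α) : divideConquer {a} = .char a := by
  rw [divideConquer, dif_neg (by simp), dif_pos (Finset.card_singleton a)]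
  simp only [Finset.min'_singleton]

theorem divideConquer_of_two_le_card {S : Finset α} (hS : 2 ≤ S.card) :
    divideConquer S =
      unionList ((halves S).map fun T => divideConquer T * divideConquer (S \ T)) := by
  rw [divideConquer, dif_neg (by omega), dif_neg (by omega)]
  congr 1
  exact List.attach_map_val (f := fun T => divideConquer T * divideConquer (S \ T))

@[elab_as_elim]
theorem halves_induction {p : Finset α → Prop} (empty : p ∅) (singleton : ∀ a, p {a})
    (split : ∀ S : Finset α, 2 ≤ S.card → (∀ T ∈ halves S, p T ∧ p (S \ T)) → p S)
    (S : Finset α) : p S := by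
  induction S using Finset.strongInduction with
  | H S ih =>
  rcases (show S.card = 0 ∨ S.card = 1 ∨ 2 ≤ S.card by omega) with h0 | h1 | h2
  · rwa [Finset.card_eq_zero.mp h0]
  · obtain ⟨a, rfl⟩ := Finset.card_eq_one.mp h1
    exact singleton a
  · refine split S h2 fun T hT => ?_
    obtain ⟨hTS, hcard⟩ := mem_halves.mp hT
    have hne : T.Nonempty := Finset.card_pos.mp (by omega)
    exact ⟨ih T (Finset.ssubset_iff_subset_ne.mpr ⟨hTS, by rintro rfl; omega⟩),
      ih _ (Finset.sdiff_ssubset hTS hne)⟩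

theorem matches'_divideConquer (S : Finset α) :
    (divideConquer S).matches' = rearrangements S.val := by
  induction S using halves_induction with
  | empty =>
    rw [divideConquer_empty, RegularExpression.matches'_epsilon]
    exact Language.ext fun _ => (Multiset.coe_eq_zero _).symm
  | singleton a =>
    rw [divideConquer_singleton, RegularExpression.matches'_char]
    exact Language.ext fun _ => Multiset.coe_eq_singleton.symm
  | split S hS ih =>
    ext w
    rw [divideConquer_of_two_le_card hS, mem_matches'_unionList,
      mem_rearrangements_val_iff_exists_mem_mul (Nat.div_le_self _ 2)]
    simp only [List.mem_map, exists_exists_and_eq_and]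
    refine exists_congr fun T => ?_
    rw [← and_assoc, ← mem_halves]
    refine and_congr_right fun hT => ?_
    rw [RegularExpression.matches'_mul, (ih T hT).1, (ih T hT).2]

theorem alphabeticLength_divideConquer (S : Finset α) :
    alphabeticLength (divideConquer S) = f S.card := by
  induction S using halves_induction with
  | empty => rw [divideConquer_empty, Finset.card_empty, f_zero]; rfl
  | singleton a => rw [divideConquer_singleton, Finset.card_singleton, f_one]; rfl
  | split S hS ih =>
    have hsummand : ∀ T ∈ halves S, alphabeticLength (divideConquer T * divideConquer (S \ T)) =
        f (S.card / 2) + f (S.card - S.card / 2) := by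
      intro T hT
      obtain ⟨hTS, hcard⟩ := mem_halves.mp hT
      rw [← hcard, ← Finset.card_sdiff_of_subset hTS, ← (ih T hT).1, ← (ih T hT).2]
      rfl
    rw [divideConquer_of_two_le_card hS, alphabeticLength_unionList, List.map_map,
      List.map_congr_left (f := _ ∘ _) hsummand, List.map_const', List.sum_replicate,
      length_halves, smul_eq_mul, ← f_eq_choose_half_mul]

theorem permLanguage_eq_rearrangements (n : ℕ) :
    permLanguage n = rearrangements (Finset.univ : Finset (Fin n)).val :=
  Language.ext fun _ => Multiset.coe_eq_coe.symm

end DivideConquer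

end PermLang

theorem theorem3_general {α : Type*} [LinearOrder α] (S : Finset α) :
    (PermLang.divideConquer S).matches' = PermLang.rearrangements S.val ∧
    PermLang.alphabeticLength (PermLang.divideConquer S) = PermLang.f S.card ∧
    ∀ r : RegularExpression α, r.matches' = PermLang.rearrangements S.val →
      PermLang.alphabeticLength (PermLang.divideConquer S) ≤ PermLang.alphabeticLength r :=
  ⟨PermLang.matches'_divideConquer S, PermLang.alphabeticLength_divideConquer S, fun _ hr =>
    (PermLang.alphabeticLength_divideConquer S).trans_le (PermLang.f_card_le_alphabeticLength hr)⟩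

theorem theorem3 (n : ℕ) (hn : 1 ≤ n) :
    (PermLang.R n).matches' = PermLang.permLanguage n ∧
    PermLang.alphabeticLength (PermLang.R n) = PermLang.f n ∧
    ∀ r : RegularExpression (Fin n), r.matches' = PermLang.permLanguage n →
      PermLang.alphabeticLength (PermLang.R n) ≤ PermLang.alphabeticLength r := by
  simpa only [PermLang.R, PermLang.permLanguage_eq_rearrangements, Finset.card_fin] using
    theorem3_general (Finset.univ : Finset (Fin n))
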